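/- Let $L>0$ and let $\rho, I_\rho, K, EI, \gamma, \delta:[0,L]\to\mathbb{R}$ be absolutely continuous and strictly positive on $[0,L]$. Put $$P_1=\begin{bmatrix}0&0&1&0\\0&0&0&1\\1&0&0&0\\0&1&0&0\end{bmatrix},\quad P_0=\begin{bmatrix}0&0&0&0\\0&0&1&0\\0&-1&0&0\\0&0&0&0\end{bmatrix},$$ $$\mathcal{H}=\mathrm{diag}\left(\tfrac1\rho,\tfrac1{I_\rho},K,EI\right),\quad G_0=\mathrm{diag}(\gamma,\delta,0,0),\quad S=\mathrm{diag}(\gamma,\delta),$$ and let $Z=L^2([0,L],\mathbb{R}^4)$ be equipped with the energy inner product $\langle z,w\rangle_Z=\int_0^L z^T\mathcal{H}w\,d\xi$ and the energy $E(z)=\frac12\langle z,z\rangle_Z$. For $z=(z_1,z_2,z_3,z_4)\in Z$ with $\mathcal{H}z\in H^1([0,L],\mathbb{R}^4)$, using the continuous representative of $\mathcal{H}z$, define $$\mathcal{B}_1z=\begin{bmatrix}\frac{1}{\rho(0)}z_1(0)\\ \frac{1}{I_\rho(0)}z_2(0)\end{bmatrix},\quad \mathcal{B}_2z=\begin{bmatrix}K(L)z_3(L)\\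 EI(L)z_4(L)\end{bmatrix},\quad \mathcal{C}_2z=\begin{bmatrix}\frac{1}{\rho(L)}z_1(L)\\ \frac{1}{I_\rho(L)}z_2(L)\end{bmatrix}.$$ Let $\mathcal{J}z=P_1\frac{\partial}{\partial\xi}(\mathcal{H}z)+(P_0-G_0)\mathcal{H}z$ with domain $$D(\mathcal{J})=\{z\in Z\mid \mathcal{H}z\in H^1,\ \mathcal{B}_1z=0,\ \mathcal{B}_2z=-S(L)\,\mathcal{C}_2z\}.$$ Then $\mathcal{J}$ generates a contraction $C_0$-semigroup $(T(t))_{t\ge0}$ on $Z$. Moreover, for every $z\in D(\mathcal{J})$ the energy $t\mapsto E(T(t)z)$ has a right derivative at $t=0$, which therefore equals the upper right Dini derivative $\dot E_+(z)=\limsup_{t\to0^+}\frac{E(T(t)z)-E(z)}{t}$, and $$\dot E_+(z)=\langle\mathcal{J}z,z\rangle_Z=-\int_0^L\left\{\frac{\gamma}{\rho^2}z_1^2+\frac{\delta}{I_\rho^2}z_2^2\right\}d\xi-(\mathcal{C}_2z)^TS(L)\,\mathcal{C}_2z.$$ -/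

import Mathlib

open MeasureTheory Set Filter Topology
open scoped Matrix NNReal

noncomputable section

/-! ### Strongly continuous semigroups and their generators -/

/-- A `C₀`-semigroup of bounded linear operators on a real normed space. -/
structure C0Semigroup (X : Type*) [NormedAddCommGroup X] [NormedSpace ℝ X] where
  toFun : ℝ≥0 → X →L[ℝ] X
  map_zero : toFun 0 = ContinuousLinearMap.id ℝ X
  map_add : ∀ s t, toFun (s + t) = (toFun s).comp (toFun t)
  tendsto_zero : ∀ x, Tendsto (fun t => toFun t x) (𝓝 0) (𝓝 x)

namespace C0Semigroup

variable {X : Type*} [NormedAddCommGroup X] [NormedSpace ℝ X]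

/-- `T` is a contraction semigroup: `‖T(t)‖ ≤ 1` for all `t ≥ 0`. -/
def IsContraction (T : C0Semigroup X) : Prop := ∀ t, ‖T.toFun t‖ ≤ 1

/-- The (possibly unbounded) operator `A` is the infinitesimal generator of `T`: `z ∈ D(A)` and
`A z = w` if and only if `(T(t) z - z) / t → w` as `t → 0⁺`. -/
def IsGeneratedBy (T : C0Semigroup X) (A : X →ₗ.[ℝ] X) : Prop :=
  ∀ z w : X, (z, w) ∈ A.graph ↔
    Tendsto (fun t : ℝ≥0 => (t : ℝ)⁻¹ • (T.toFun t z - z)) (𝓝[>] 0) (𝓝 w)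

/-- The upper right Dini derivative at `t = 0` of `V` along the trajectory `t ↦ T(t) z`. -/
def diniDeriv (T : C0Semigroup X) (V : X → ℝ) (z : X) : EReal :=
  limsup (fun t : ℝ≥0 => (((V (T.toFun t z) - V z) / (t : ℝ) : ℝ) : EReal)) (𝓝[>] 0)

end C0Semigroup

/-! ### The Sobolev space `H¹(0, L)` -/

/-- `u` is the absolutely continuous representative on `[0, L]` of the `H¹` function `f`:
`f = u` almost everywhere on `[0, L]`, `u` is absolutely continuous and `u' ∈ L²`. -/
structure IsH1Rep (L : ℝ) (f u : ℝ → ℝ) : Prop where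
  ae_eq : f =ᵐ[volume.restrict (Icc 0 L)] u
  ac : AbsolutelyContinuousOnInterval u 0 L
  memLp : MemLp (deriv u) 2 (volume.restrict (Icc 0 L))

/-- `f ∈ H¹(0, L)`. -/
def MemH1 (L : ℝ) (f : ℝ → ℝ) : Prop := ∃ u, IsH1Rep L f u

open Classical in
/-- The absolutely continuous representative of `f ∈ H¹(0, L)` (unique on `[0, L]`); its value is
the zero function if `f` is not in `H¹(0, L)`. -/
def h1Rep (L : ℝ) (f : ℝ → ℝ) : ℝ → ℝ := if h : MemH1 L f then h.choose else 0

theorem MemH1.isH1Rep {L : ℝ} {f : ℝ → ℝ} (h : MemH1 L f) : IsH1Rep L f (h1Rep L f) := by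
  rw [h1Rep, dif_pos h]; exact h.choose_spec

namespace IsH1Rep

variable {L : ℝ} {f g u v : ℝ → ℝ}

theorem continuousOn (hL : 0 < L) (h : IsH1Rep L f u) : ContinuousOn u (Icc 0 L) := by
  have := h.ac.continuousOn
  rwa [uIcc_of_le hL.le] at this

theorem eqOn (hL : 0 < L) (h : IsH1Rep L f u) (h' : IsH1Rep L f v) : EqOn u v (Icc 0 L) :=
  Measure.eqOn_Icc_of_ae_eq volume hL.ne (h.ae_eq.symm.trans h'.ae_eq)
    (h.continuousOn hL) (h'.continuousOn hL)

theorem congr (h : IsH1Rep L f u) (hfg : f =ᵐ[volume.restrict (Icc 0 L)] g) : IsH1Rep L g u :=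
  ⟨hfg.symm.trans h.ae_eq, h.ac, h.memLp⟩

theorem deriv_ae_eq (hL : 0 < L) (h : IsH1Rep L f u) (h' : IsH1Rep L f v) :
    deriv u =ᵐ[volume.restrict (Icc 0 L)] deriv v := by
  rw [← restrict_Ioo_eq_restrict_Icc]
  filter_upwards [ae_restrict_mem measurableSet_Ioo] with x hx
  apply Filter.EventuallyEq.deriv_eq
  filter_upwards [Ioo_mem_nhds hx.1 hx.2] with y hy
  exact h.eqOn hL h' (Ioo_subset_Icc_self hy)

theorem ae_differentiableAt (hL : 0 < L) (h : IsH1Rep L f u) :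
    ∀ᵐ x ∂(volume.restrict (Icc 0 L)), DifferentiableAt ℝ u x := by
  have := h.ac.ae_differentiableAt
  rw [uIcc_of_le hL.le] at this
  exact (ae_restrict_iff' measurableSet_Icc).2 this

theorem deriv_add (hL : 0 < L) (h : IsH1Rep L f u) (h' : IsH1Rep L g v) :
    deriv (u + v) =ᵐ[volume.restrict (Icc 0 L)] deriv u + deriv v := by
  filter_upwards [h.ae_differentiableAt hL, h'.ae_differentiableAt hL] with x hx hx'
  simp [_root_.deriv_add hx hx']

theorem deriv_smul (c : ℝ) (u : ℝ → ℝ) : deriv (c • u) = c • deriv u := by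
  ext x; simpa using deriv_const_smul_field c u (x := x)

theorem add (hL : 0 < L) (h : IsH1Rep L f u) (h' : IsH1Rep L g v) :
    IsH1Rep L (f + g) (u + v) :=
  ⟨h.ae_eq.add h'.ae_eq, h.ac.add h'.ac,
    (memLp_congr_ae (h.deriv_add hL h')).2 (h.memLp.add h'.memLp)⟩

theorem smul (c : ℝ) (h : IsH1Rep L f u) : IsH1Rep L (c • f) (c • u) :=
  ⟨h.ae_eq.const_smul c, h.ac.const_smul c, by
    rw [deriv_smul]; exact h.memLp.const_smul c⟩

end IsH1Rep

/-! ### The damped Timoshenko beam -/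

/-- The data of a viscously damped Timoshenko beam on `[0, L]`: the density `ρ`, the mass moment of
inertia `Iρ`, the shear stiffness `K`, the bending stiffness `EI` and the viscous damping
coefficients `γ`, `δ`, all absolutely continuous and positive on `[0, L]`. -/
structure TimoshenkoBeam where
  L : ℝ
  ρ : ℝ → ℝ
  Iρ : ℝ → ℝ
  K : ℝ → ℝ
  EI : ℝ → ℝ
  γ : ℝ → ℝ
  δ : ℝ → ℝ
  L_pos : 0 < L
  ρ_ac : AbsolutelyContinuousOnInterval ρ 0 L
  Iρ_ac : AbsolutelyContinuousOnInterval Iρ 0 L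
  K_ac : AbsolutelyContinuousOnInterval K 0 L
  EI_ac : AbsolutelyContinuousOnInterval EI 0 L
  γ_ac : AbsolutelyContinuousOnInterval γ 0 L
  δ_ac : AbsolutelyContinuousOnInterval δ 0 L
  ρ_pos : ∀ ξ ∈ Icc 0 L, 0 < ρ ξ
  Iρ_pos : ∀ ξ ∈ Icc 0 L, 0 < Iρ ξ
  K_pos : ∀ ξ ∈ Icc 0 L, 0 < K ξ
  EI_pos : ∀ ξ ∈ Icc 0 L, 0 < EI ξ
  γ_pos : ∀ ξ ∈ Icc 0 L, 0 < γ ξ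
  δ_pos : ∀ ξ ∈ Icc 0 L, 0 < δ ξ

namespace TimoshenkoBeam

variable (b : TimoshenkoBeam)

/-- Lebesgue measure on `[0, L]`. -/
abbrev μ : Measure ℝ := volume.restrict (Icc 0 b.L)

def P₁ : Matrix (Fin 4) (Fin 4) ℝ :=
  !![0, 0, 1, 0;
     0, 0, 0, 1;
     1, 0, 0, 0;
     0, 1, 0, 0]

def P₀ : Matrix (Fin 4) (Fin 4) ℝ :=
  !![0, 0, 0, 0;
     0, 0, 1, 0;
     0, -1, 0, 0;
     0, 0, 0, 0]

def G₀ (ξ : ℝ) : Matrix (Fin 4) (Fin 4) ℝ := Matrix.diagonal ![b.γ ξ, b.δ ξ, 0, 0]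

/-- The diagonal of the Hamiltonian density matrix `ℋ`. -/
def h (ξ : ℝ) : Fin 4 → ℝ := ![1 / b.ρ ξ, 1 / b.Iρ ξ, b.K ξ, b.EI ξ]

/-- The Hamiltonian density matrix `ℋ(ξ)`. -/
def H (ξ : ℝ) : Matrix (Fin 4) (Fin 4) ℝ := Matrix.diagonal (b.h ξ)

/-- The damping matrix `S = diag(γ, δ)`. -/
def S (ξ : ℝ) : Matrix (Fin 2) (Fin 2) ℝ := Matrix.diagonal ![b.γ ξ, b.δ ξ]

/-- The state space `Z`: as a vector space it is `L²([0, L], ℝ⁴)`; below it is given the norm of the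
energy inner product instead of the usual `L²` norm. -/
def Z : Type := Lp (EuclideanSpace ℝ (Fin 4)) 2 b.μ

instance : AddCommGroup b.Z :=
  inferInstanceAs (AddCommGroup (Lp (EuclideanSpace ℝ (Fin 4)) 2 b.μ))

instance : Module ℝ b.Z :=
  inferInstanceAs (Module ℝ (Lp (EuclideanSpace ℝ (Fin 4)) 2 b.μ))

/-- The identification of `Z` with the space `L²([0, L], ℝ⁴)`. -/
def toL2 : b.Z ≃ₗ[ℝ] Lp (EuclideanSpace ℝ (Fin 4)) 2 b.μ := LinearEquiv.refl ℝ _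

variable {b}

/-- The components `z₁, …, z₄` of (a representative of) a state `z`; their indices run from `0`. -/
def comp (z : b.Z) (ξ : ℝ) : Fin 4 → ℝ := fun i => b.toL2 z ξ i

theorem comp_add (z w : b.Z) : comp (z + w) =ᵐ[b.μ] fun ξ => comp z ξ + comp w ξ := by
  filter_upwards [Lp.coeFn_add (b.toL2 z) (b.toL2 w)] with ξ hξ
  ext i
  have h := congrArg (fun v : EuclideanSpace ℝ (Fin 4) => v i) hξ
  exact h

theorem comp_smul (c : ℝ) (z : b.Z) : comp (c • z) =ᵐ[b.μ] fun ξ => c • comp z ξ := by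
  filter_upwards [Lp.coeFn_smul c (b.toL2 z)] with ξ hξ
  ext i
  simp [comp, hξ]

theorem memLp_comp (z : b.Z) (i : Fin 4) : MemLp (fun ξ => comp z ξ i) 2 b.μ :=
  (EuclideanSpace.proj i : EuclideanSpace ℝ (Fin 4) →L[ℝ] ℝ).comp_memLp' (Lp.memLp (b.toL2 z))

theorem eq_of_comp_ae_eq {z w : b.Z} (hzw : comp z =ᵐ[b.μ] comp w) : z = w := by
  apply b.toL2.injective
  apply Lp.ext
  filter_upwards [hzw] with ξ hξ
  ext i
  exact congrFun hξ i

theorem continuousOn_of_ac {f : ℝ → ℝ} (hf : AbsolutelyContinuousOnInterval f 0 b.L) :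
    ContinuousOn f (Icc 0 b.L) := by
  have := hf.continuousOn
  rwa [uIcc_of_le b.L_pos.le] at this

theorem continuousOn_h (i : Fin 4) : ContinuousOn (fun ξ => b.h ξ i) (Icc 0 b.L) := by
  fin_cases i
  · exact continuousOn_const.div (continuousOn_of_ac b.ρ_ac) fun ξ hξ => (b.ρ_pos ξ hξ).ne'
  · exact continuousOn_const.div (continuousOn_of_ac b.Iρ_ac) fun ξ hξ => (b.Iρ_pos ξ hξ).ne'
  · exact continuousOn_of_ac b.K_ac
  · exact continuousOn_of_ac b.EI_ac

theorem h_pos {ξ : ℝ} (hξ : ξ ∈ Icc 0 b.L) (i : Fin 4) : 0 < b.h ξ i := by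
  fin_cases i
  · exact one_div_pos.2 (b.ρ_pos ξ hξ)
  · exact one_div_pos.2 (b.Iρ_pos ξ hξ)
  · exact b.K_pos ξ hξ
  · exact b.EI_pos ξ hξ

theorem memLp_continuousOn_mul {a f : ℝ → ℝ} (ha : ContinuousOn a (Icc 0 b.L))
    (hf : MemLp f 2 b.μ) : MemLp (fun ξ => a ξ * f ξ) 2 b.μ := by
  obtain ⟨C, hC⟩ := isCompact_Icc.exists_bound_of_continuousOn ha
  refine hf.of_le_mul (c := C)
    ((ha.aestronglyMeasurable measurableSet_Icc).mul hf.aestronglyMeasurable) ?_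
  filter_upwards [ae_restrict_mem measurableSet_Icc] with ξ hξ
  rw [norm_mul]
  exact mul_le_mul_of_nonneg_right (hC ξ hξ) (norm_nonneg _)

/-- The energy inner product `⟨z, w⟩_Z = ∫₀ᴸ zᵀ ℋ w dξ`. -/
def energyInner (z w : b.Z) : ℝ := ∫ ξ in 0..b.L, comp z ξ ⬝ᵥ (b.H ξ *ᵥ comp w ξ)

theorem dotProduct_H (ξ : ℝ) (x y : Fin 4 → ℝ) :
    x ⬝ᵥ (b.H ξ *ᵥ y) = ∑ i, x i * (b.h ξ i * y i) := by
  simp [dotProduct, H, Matrix.mulVec_diagonal]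

theorem energyInner_eq (z w : b.Z) :
    energyInner z w = ∫ ξ, ∑ i, comp z ξ i * (b.h ξ i * comp w ξ i) ∂b.μ := by
  rw [energyInner, intervalIntegral.integral_of_le b.L_pos.le, ← integral_Icc_eq_integral_Ioc]
  simp_rw [dotProduct_H]

theorem integrable_energy (z w : b.Z) :
    Integrable (fun ξ => ∑ i, comp z ξ i * (b.h ξ i * comp w ξ i)) b.μ :=
  integrable_finsetSum _ fun i _ =>
    (memLp_comp z i).integrable_mul (memLp_continuousOn_mul (continuousOn_h i) (memLp_comp w i))

variable (b) in
/-- The energy inner product is an inner product on `Z`. -/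
@[reducible] def energyCore : InnerProductSpace.Core ℝ b.Z where
  inner := energyInner
  conj_inner_symm z w := by
    simp only [conj_trivial, energyInner_eq]
    congr 1 with ξ
    exact Finset.sum_congr rfl fun i _ => by ring
  re_inner_nonneg z := by
    simp only [energyInner_eq, RCLike.re_to_real]
    apply integral_nonneg_of_ae
    filter_upwards [ae_restrict_mem measurableSet_Icc] with ξ hξ
    refine Finset.sum_nonneg fun i _ => ?_
    nlinarith [mul_nonneg (h_pos hξ i).le (mul_self_nonneg (comp z ξ i))]
  add_left x y z := by
    simp only [energyInner_eq]
    rw [← integral_add (integrable_energy x z) (integrable_energy y z)]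
    apply integral_congr_ae
    filter_upwards [comp_add x y] with ξ hξ
    rw [← Finset.sum_add_distrib]
    exact Finset.sum_congr rfl fun i _ => by rw [hξ, Pi.add_apply]; ring
  smul_left x y r := by
    simp only [energyInner_eq, conj_trivial]
    rw [← integral_const_mul]
    apply integral_congr_ae
    filter_upwards [comp_smul r x] with ξ hξ
    rw [Finset.mul_sum]
    exact Finset.sum_congr rfl fun i _ => by rw [hξ, Pi.smul_apply, smul_eq_mul]; ring
  definite z hz := by
    simp only [energyInner_eq] at hz
    have hterm : ∀ᵐ ξ ∂b.μ, ∀ i, 0 ≤ comp z ξ i * (b.h ξ i * comp z ξ i) := by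
      filter_upwards [ae_restrict_mem measurableSet_Icc] with ξ hξ i
      nlinarith [mul_nonneg (h_pos hξ i).le (mul_self_nonneg (comp z ξ i))]
    rw [integral_eq_zero_iff_of_nonneg_ae
      (hterm.mono fun ξ hξ => Finset.sum_nonneg fun i _ => hξ i) (integrable_energy z z)] at hz
    apply b.toL2.injective
    rw [LinearEquiv.map_zero, ← Lp.eq_zero_iff_ae_eq_zero.symm]
    filter_upwards [hz, hterm, ae_restrict_mem measurableSet_Icc] with ξ h0 hn hξ
    ext i
    have h1 := (Finset.sum_eq_zero_iff_of_nonneg fun i _ => hn i).1 h0 i (Finset.mem_univ i)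
    have h2 := (h_pos hξ i).ne'
    simp only [mul_eq_zero, h2, false_or, or_self] at h1
    simpa [comp] using h1

instance : NormedAddCommGroup b.Z := b.energyCore.toNormedAddCommGroup

instance : InnerProductSpace ℝ b.Z := InnerProductSpace.ofCore b.energyCore.toCore

/-- The energy `E(z) = ½ ⟨z, z⟩_Z`. -/
def energy (z : b.Z) : ℝ := 1 / 2 * inner ℝ z z

/-- The components of the co-energy variables `ℋ z`. -/
def coenergy (z : b.Z) (i : Fin 4) : ℝ → ℝ := fun ξ => (b.H ξ *ᵥ comp z ξ) i

/-- The absolutely continuous representatives of the components of `ℋ z`, when `ℋ z ∈ H¹`. -/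
def coenergyRep (z : b.Z) (i : Fin 4) : ℝ → ℝ := h1Rep b.L (coenergy z i)

/-- `ℬ₁ z = ((ℋz)₁(0), (ℋz)₂(0))`, the velocities at the clamped end. -/
def B₁ (z : b.Z) : Fin 2 → ℝ := ![coenergyRep z 0 0, coenergyRep z 1 0]

/-- `ℬ₂ z = ((ℋz)₃(L), (ℋz)₄(L))`, the force and the torque at the end `L`. -/
def B₂ (z : b.Z) : Fin 2 → ℝ := ![coenergyRep z 2 b.L, coenergyRep z 3 b.L]

/-- `𝒞₂ z = ((ℋz)₁(L), (ℋz)₂(L))`, the velocities at the end `L`. -/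
def C₂ (z : b.Z) : Fin 2 → ℝ := ![coenergyRep z 0 b.L, coenergyRep z 1 b.L]

theorem coenergy_add (z w : b.Z) (i : Fin 4) :
    coenergy z i + coenergy w i =ᵐ[b.μ] coenergy (z + w) i := by
  filter_upwards [comp_add z w] with ξ hξ
  simp [coenergy, hξ, Matrix.mulVec_add]

theorem coenergy_smul (c : ℝ) (z : b.Z) (i : Fin 4) :
    c • coenergy z i =ᵐ[b.μ] coenergy (c • z) i := by
  filter_upwards [comp_smul c z] with ξ hξ
  simp [coenergy, hξ, Matrix.mulVec_smul]

theorem isH1Rep_add {z w : b.Z} (hz : ∀ i, MemH1 b.L (coenergy z i))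
    (hw : ∀ i, MemH1 b.L (coenergy w i)) (i : Fin 4) :
    IsH1Rep b.L (coenergy (z + w) i) (coenergyRep z i + coenergyRep w i) :=
  ((hz i).isH1Rep.add b.L_pos (hw i).isH1Rep).congr (coenergy_add z w i)

theorem isH1Rep_smul (c : ℝ) {z : b.Z} (hz : ∀ i, MemH1 b.L (coenergy z i)) (i : Fin 4) :
    IsH1Rep b.L (coenergy (c • z) i) (c • coenergyRep z i) :=
  ((hz i).isH1Rep.smul c).congr (coenergy_smul c z i)

theorem coenergyRep_eqOn {z : b.Z} {i : Fin 4} {u : ℝ → ℝ} (hu : IsH1Rep b.L (coenergy z i) u) :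
    EqOn (coenergyRep z i) u (Icc 0 b.L) :=
  (MemH1.isH1Rep ⟨u, hu⟩).eqOn b.L_pos hu

theorem coenergyRep_zero {z : b.Z} {i : Fin 4} {u : ℝ → ℝ} (hu : IsH1Rep b.L (coenergy z i) u) :
    coenergyRep z i 0 = u 0 := coenergyRep_eqOn hu ⟨le_rfl, b.L_pos.le⟩

theorem coenergyRep_L {z : b.Z} {i : Fin 4} {u : ℝ → ℝ} (hu : IsH1Rep b.L (coenergy z i) u) :
    coenergyRep z i b.L = u b.L := coenergyRep_eqOn hu ⟨b.L_pos.le, le_rfl⟩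

variable (b) in
/-- The domain `D(𝒥) = {z ∈ Z | ℋz ∈ H¹, ℬ₁z = 0, ℬ₂z = -S(L) 𝒞₂z}`. -/
def domJ : Submodule ℝ b.Z where
  carrier := {z | (∀ i, MemH1 b.L (coenergy z i)) ∧ B₁ z = 0 ∧ B₂ z = -(b.S b.L *ᵥ C₂ z)}
  zero_mem' := by
    have h0 : ∀ i, IsH1Rep b.L (coenergy (0 : b.Z) i) ((0 : ℝ) • (0 : ℝ → ℝ)) := fun i => by
      have : IsH1Rep b.L (0 : ℝ → ℝ) 0 :=
        ⟨EventuallyEq.rfl, by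
          exact (LipschitzWith.const (0 : ℝ)).lipschitzOnWith.absolutelyContinuousOnInterval,
          by
            have : deriv (0 : ℝ → ℝ) = 0 := by ext; simp
            rw [this]; exact MemLp.zero⟩
      rw [zero_smul]
      refine this.congr ?_
      have := coenergy_smul (0 : ℝ) (0 : b.Z) i
      rwa [zero_smul, zero_smul] at this
    refine ⟨fun i => ⟨_, h0 i⟩, ?_, ?_⟩
    · ext i
      fin_cases i <;> simp [B₁, coenergyRep_zero (h0 _)]
    · ext i
      fin_cases i <;> simp [B₂, C₂, S, coenergyRep_L (h0 _)]
  add_mem' := by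
    rintro z w ⟨hz, hz1, hz2⟩ ⟨hw, hw1, hw2⟩
    have hr := isH1Rep_add hz hw
    refine ⟨fun i => ⟨_, hr i⟩, ?_, ?_⟩
    · have : B₁ (z + w) = B₁ z + B₁ w := by
        ext i
        fin_cases i <;> simp [B₁, coenergyRep_zero (hr _)]
      rw [this, hz1, hw1, add_zero]
    · have h1 : B₂ (z + w) = B₂ z + B₂ w := by
        ext i
        fin_cases i <;> simp [B₂, coenergyRep_L (hr _)]
      have h2 : C₂ (z + w) = C₂ z + C₂ w := by
        ext i
        fin_cases i <;> simp [C₂, coenergyRep_L (hr _)]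
      rw [h1, h2, hz2, hw2, Matrix.mulVec_add, neg_add]
  smul_mem' := by
    rintro c z ⟨hz, hz1, hz2⟩
    have hr := isH1Rep_smul c hz
    refine ⟨fun i => ⟨_, hr i⟩, ?_, ?_⟩
    · have : B₁ (c • z) = c • B₁ z := by
        ext i
        fin_cases i <;> simp [B₁, coenergyRep_zero (hr _)]
      rw [this, hz1, smul_zero]
    · have h1 : B₂ (c • z) = c • B₂ z := by
        ext i
        fin_cases i <;> simp [B₂, coenergyRep_L (hr _)]
      have h2 : C₂ (c • z) = c • C₂ z := by
        ext i
        fin_cases i <;> simp [C₂, coenergyRep_L (hr _)]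
      rw [h1, h2, hz2, Matrix.mulVec_smul, smul_neg]

/-- The function `P₁ ∂_ξ(ℋz) + (P₀ - G₀) ℋz`. -/
def JFun (z : b.Z) (ξ : ℝ) : EuclideanSpace ℝ (Fin 4) :=
  WithLp.toLp 2 (P₁ *ᵥ (fun i => deriv (coenergyRep z i) ξ) +
    (P₀ - b.G₀ ξ) *ᵥ (fun i => coenergyRep z i ξ))

theorem memLp_JFun {z : b.Z} (hz : z ∈ b.domJ) : MemLp (JFun z) 2 b.μ := by
  have hd : ∀ i, MemLp (deriv (coenergyRep z i)) 2 b.μ := fun i => (hz.1 i).isH1Rep.memLp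
  have hc : ∀ i, MemLp (coenergyRep z i) 2 b.μ := fun i => by
    have := memLp_continuousOn_mul (b := b) ((hz.1 i).isH1Rep.continuousOn b.L_pos)
      (memLp_const (1 : ℝ))
    simp only [mul_one] at this
    exact this
  have hG : ∀ i j, ContinuousOn (fun ξ => (P₀ - b.G₀ ξ) i j) (Icc 0 b.L) := fun i j => by
    have hγ := continuousOn_of_ac b.γ_ac
    have hδ := continuousOn_of_ac b.δ_ac
    simp only [Matrix.sub_apply, G₀, Matrix.diagonal_apply]
    refine continuousOn_const.sub ?_
    split_ifs with hij
    · fin_cases i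
      · exact hγ
      · exact hδ
      · exact continuousOn_const
      · exact continuousOn_const
    · exact continuousOn_const
  rw [memLp_piLp_iff]
  intro i
  simp only [JFun, Pi.add_apply, Matrix.mulVec, dotProduct]
  exact (memLp_finsetSum _ fun j _ => (hd j).const_mul _).add
    (memLp_finsetSum _ fun j _ => memLp_continuousOn_mul (hG i j) (hc j))

variable (b) in
/-- The operator `𝒥 z = P₁ ∂_ξ(ℋz) + (P₀ - G₀) ℋz` with domain `D(𝒥)`. -/
def J : b.Z →ₗ.[ℝ] b.Z where
  domain := b.domJ
  toFun :=
    { toFun := fun z => b.toL2.symm ((memLp_JFun z.2).toLp (JFun z.1))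
      map_add' := fun z w => by
        rw [← LinearEquiv.map_add, ← MemLp.toLp_add]
        congr 1
        apply MemLp.toLp_congr
        have hr := isH1Rep_add z.2.1 w.2.1
        have hd : ∀ᵐ ξ ∂b.μ, ∀ i, deriv (coenergyRep ((z + w : b.domJ) : b.Z) i) ξ =
            deriv (coenergyRep z.1 i) ξ + deriv (coenergyRep w.1 i) ξ := ae_all_iff.2 fun i =>
          ((MemH1.isH1Rep ⟨_, hr i⟩).deriv_ae_eq b.L_pos (hr i)).trans
            ((z.2.1 i).isH1Rep.deriv_add b.L_pos (w.2.1 i).isH1Rep)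
        filter_upwards [hd, ae_restrict_mem measurableSet_Icc] with ξ h1 hξ
        have h2 : ∀ i, coenergyRep ((z + w : b.domJ) : b.Z) i ξ =
          coenergyRep z.1 i ξ + coenergyRep w.1 i ξ := fun i => coenergyRep_eqOn (hr i) hξ
        simp only [JFun, Pi.add_apply, h1, h2]
        rw [← WithLp.toLp_add]
        congr 1
        have e1 := Matrix.mulVec_add P₁ (fun i => deriv (coenergyRep z.1 i) ξ)
          (fun i => deriv (coenergyRep w.1 i) ξ)
        have e2 := Matrix.mulVec_add (P₀ - b.G₀ ξ) (fun i => coenergyRep z.1 i ξ)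
          (fun i => coenergyRep w.1 i ξ)
        refine (congrArg₂ (· + ·) e1 e2).trans ?_
        abel
      map_smul' := fun c z => by
        rw [RingHom.id_apply, ← LinearEquiv.map_smul, ← MemLp.toLp_const_smul]
        congr 1
        apply MemLp.toLp_congr
        have hr := isH1Rep_smul c z.2.1
        have hd : ∀ᵐ ξ ∂b.μ, ∀ i, deriv (coenergyRep ((c • z : b.domJ) : b.Z) i) ξ =
            c * deriv (coenergyRep z.1 i) ξ := ae_all_iff.2 fun i => by
          have := (MemH1.isH1Rep ⟨_, hr i⟩).deriv_ae_eq b.L_pos (hr i)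
          rw [IsH1Rep.deriv_smul] at this
          exact this
        filter_upwards [hd, ae_restrict_mem measurableSet_Icc] with ξ h1 hξ
        have h2 : ∀ i, coenergyRep ((c • z : b.domJ) : b.Z) i ξ =
          c * coenergyRep z.1 i ξ := fun i => coenergyRep_eqOn (hr i) hξ
        simp only [JFun, Pi.smul_apply, h1, h2]
        rw [← WithLp.toLp_smul]
        congr 1
        have e1 := Matrix.mulVec_smul P₁ c (fun i => deriv (coenergyRep z.1 i) ξ)
        have e2 := Matrix.mulVec_smul (P₀ - b.G₀ ξ) c (fun i => coenergyRep z.1 i ξ)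
        refine (congrArg₂ (· + ·) e1 e2).trans ?_
        rw [smul_add] }

end TimoshenkoBeam

end

noncomputable section

/-! ### Bounded dissipative operators on a Hilbert space -/

/-! Write `u = ℋz`, with components indexed from 0. In the energy inner product the weight `ℋ` turns
`⟨𝒥z, z⟩` into the integral of `(𝒥z)ᵀu`. The `P₁` terms add up to the derivative of `u₀u₂ + u₁u₃`,
the skew matrix `P₀` cancels, and `G₀` leaves the viscous loss. The boundary term vanishes at 0 and
equals `-(𝒞₂z)ᵀS(L)𝒞₂z` at `L` because of the feedback condition. This is `inner_J`; it gives the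
dissipation formula and shows that `𝒥` is dissipative.

The equation `𝒥z = w` is triangular: `u₁' = w₃`, `u₀' = w₂ + u₁`, `u₂' = w₀ + γu₀`, `u₃' = w₁ + δu₁
- u₂`. Integrating the first two from 0 and the last two from `L` shows that `𝒥` is a bijection from
its domain onto `Z`. Its inverse `R` is dissipative and defined everywhere, hence bounded with dense
range.

Generation is then a statement about `R` alone. The Yosida approximations of `R⁻¹` are the bounded
operators `-n(1 - nR)⁻¹`; they are dissipative, commute, and converge to `R⁻¹` on the range of `R`.
Their exponentials are contractions and converge strongly to the semigroup. The energy derivative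
follows by differentiating the square of the norm. -/

theorem eq_zero_of_forall_mul_add_sq_mul_nonpos {a c : ℝ}
    (h : ∀ s : ℝ, s * a + s ^ 2 * c ≤ 0) : a = 0 := by
  have hd : (0 : ℝ) < 1 + |c| := by positivity
  -- A small multiple of `a` lets the linear term win: the expression becomes a square times `1 +
  -- |c| + c ≥ 1`.
  have h1 := h (a / (1 + |c|))
  have h2 : a / (1 + |c|) * a + (a / (1 + |c|)) ^ 2 * c
      = (a / (1 + |c|)) ^ 2 * (1 + |c| + c) := by
    field_simp
  have h3 : 1 ≤ 1 + |c| + c := by linarith [neg_abs_le c]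
  have h4 : (a / (1 + |c|)) ^ 2 ≤ 0 := by nlinarith [sq_nonneg (a / (1 + |c|))]
  have h5 : a / (1 + |c|) = 0 := by
    have := le_antisymm h4 (sq_nonneg _)
    simpa using this
  simpa [hd.ne'] using h5

namespace Dissipative

variable {X : Type*} [NormedAddCommGroup X] [InnerProductSpace ℝ X]

/-- Closed graph theorem. If `u n → x` and `R (u n) → y`, dissipativity at `u n - x + s • w` gives
in the limit `s⟨y - R x, w⟩ + s²⟨R w, w⟩ ≤ 0` for every `s`, so `y = R x`. -/
theorem continuous_of_inner_self_nonpos [CompleteSpace X] (R : X →ₗ[ℝ] X)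
    (hR : ∀ x, inner ℝ (R x) x ≤ 0) : Continuous R := by
  refine R.continuous_of_seq_closed_graph fun u x y hu hRu => ?_
  rw [← sub_eq_zero]
  refine ext_inner_right ℝ fun w => ?_
  rw [inner_zero_left]
  refine eq_zero_of_forall_mul_add_sq_mul_nonpos (c := inner ℝ (R w) w) fun s => ?_
  have h1 : Tendsto (fun n => inner ℝ (R (u n - x + s • w)) (u n - x + s • w)) atTop
      (𝓝 (inner ℝ (y - R x + s • R w) (x - x + s • w))) := by
    simp only [map_add, map_sub, map_smul]
    exact ((hRu.sub_const _).add_const _).inner ((hu.sub_const _).add_const _)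
  have h2 := le_of_tendsto' h1 fun n => hR _
  simp only [sub_self, zero_add, inner_add_left, inner_smul_right, inner_smul_left,
    conj_trivial] at h2
  linarith

/-- For `v` orthogonal to the range, dissipativity at `v + s • w` reads `s⟨R v, w⟩ + s²⟨R w, w⟩ ≤
0`. Hence `R v = 0`, and injectivity gives `v = 0`. -/
theorem denseRange [CompleteSpace X] (R : X →L[ℝ] X) (hR : ∀ x, inner ℝ (R x) x ≤ 0)
    (hinj : Function.Injective R) : DenseRange R := by
  have h0 : (LinearMap.range R.toLinearMap)ᗮ = ⊥ := by
    rw [Submodule.eq_bot_iff]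
    intro v hv
    have hv' : ∀ x, inner ℝ (R x) v = 0 := fun x =>
      (Submodule.mem_orthogonal _ _).1 hv _ ⟨x, rfl⟩
    apply hinj
    rw [map_zero]
    refine ext_inner_right ℝ fun w => ?_
    rw [inner_zero_left]
    refine eq_zero_of_forall_mul_add_sq_mul_nonpos (c := inner ℝ (R w) w) fun s => ?_
    have h := hR (v + s • w)
    simp only [map_add, map_smul, inner_add_left, inner_add_right, inner_smul_left,
      inner_smul_right, hv', conj_trivial] at h
    linarith
  have h1 : (LinearMap.range R.toLinearMap).topologicalClosure = ⊤ :=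
    (Submodule.topologicalClosure_eq_top_iff).2 h0
  have h2 := Submodule.dense_iff_topologicalClosure_eq_top.2 h1
  rw [LinearMap.coe_range] at h2
  exact h2

/-- The operator `(1 - l R)⁻¹`. -/
def resolvent (R : X →L[ℝ] X) (l : ℝ) : X →L[ℝ] X := Ring.inverse (1 - l • R)

/-- The Yosida approximation `-l (1 - l R)⁻¹` of the inverse of `R`. -/
def yosida (R : X →L[ℝ] X) (l : ℝ) : X →L[ℝ] X := -(l • resolvent R l)

theorem commute_yosida (R : X →L[ℝ] X) (l m : ℝ) : Commute (yosida R l) (yosida R m) := by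
  have h : Commute (1 - l • R) (1 - m • R) :=
    ((Commute.one_left _).sub_left
      (((Commute.one_right _).sub_right ((Commute.refl R).smul_right m)).smul_left l))
  exact (((h.ringInverse_ringInverse).smul_left l).smul_right m).neg_left.neg_right

section

variable [CompleteSpace X] {R : X →L[ℝ] X}

/-- Lax–Milgram: dissipativity makes the form `⟨(1 - l R)v, w⟩` coercive with constant 1. -/
theorem isUnit_one_sub_smul (hR : ∀ x, inner ℝ (R x) x ≤ 0) {l : ℝ} (hl : 0 ≤ l) :
    IsUnit (1 - l • R) := by
  let B : X →L[ℝ] X →L[ℝ] ℝ := (innerSL ℝ).comp (1 - l • R)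
  have hB : ∀ v w, B v w = inner ℝ ((1 - l • R) v) w := fun v w => rfl
  have hc : IsCoercive B := ⟨1, one_pos, fun u => by
    rw [hB]
    simp only [sub_apply, one_apply_eq_self,
      smul_apply, inner_sub_left, inner_smul_left,
      real_inner_self_eq_norm_mul_norm, conj_trivial]
    nlinarith [mul_nonneg hl (neg_nonneg.2 (hR u))]⟩
  have he : (1 - l • R) = (hc.continuousLinearEquivOfBilin : X →L[ℝ] X) := by
    ext v
    exact hc.unique_continuousLinearEquivOfBilin fun w => (hB v w).symm
  rw [he]
  exact ⟨(ContinuousLinearEquiv.unitsEquiv ℝ X).symm hc.continuousLinearEquivOfBilin, rfl⟩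

theorem resolvent_sub_smul (hR : ∀ x, inner ℝ (R x) x ≤ 0) {l : ℝ} (hl : 0 ≤ l) (x : X) :
    resolvent R l x - l • R (resolvent R l x) = x := by
  have := Ring.mul_inverse_cancel _ (isUnit_one_sub_smul hR hl)
  exact congrArg (fun f : X →L[ℝ] X => f x) this

theorem resolvent_apply_sub (hR : ∀ x, inner ℝ (R x) x ≤ 0) {l : ℝ} (hl : 0 ≤ l) (x : X) :
    resolvent R l x - l • resolvent R l (R x) = x := by
  have := Ring.inverse_mul_cancel _ (isUnit_one_sub_smul hR hl)
  have := congrArg (fun f : X →L[ℝ] X => f x) this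
  simpa [resolvent] using this

theorem norm_resolvent_le (hR : ∀ x, inner ℝ (R x) x ≤ 0) {l : ℝ} (hl : 0 ≤ l) (x : X) :
    ‖resolvent R l x‖ ≤ ‖x‖ := by
  have h1 := resolvent_sub_smul hR hl x
  set y := resolvent R l x
  have h2 : ‖y‖ * ‖y‖ ≤ inner ℝ x y := by
    rw [← h1, inner_sub_left, inner_smul_left, real_inner_self_eq_norm_mul_norm, conj_trivial]
    nlinarith [mul_nonneg hl (neg_nonneg.2 (hR y))]
  have h3 := real_inner_le_norm x y
  by_contra! h4
  nlinarith [norm_nonneg x]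

/-- Reduces the convergence of the Yosida approximations on the range of `R` to the strong
convergence of `(1 - l R)⁻¹` to 0. -/
theorem yosida_apply_range (hR : ∀ x, inner ℝ (R x) x ≤ 0) {l : ℝ} (hl : 0 ≤ l) (y : X) :
    yosida R l (R y) = y - resolvent R l y := by
  have h := resolvent_apply_sub hR hl y
  simp only [yosida, neg_apply, smul_apply]
  nth_rewrite 2 [← h]
  abel

/-- With `x = y - l R y`, the inner product equals `-l(‖y‖² - l⟨R y, y⟩)`. -/
theorem inner_yosida_nonpos (hR : ∀ x, inner ℝ (R x) x ≤ 0) {l : ℝ} (hl : 0 ≤ l) (x : X) :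
    inner ℝ (yosida R l x) x ≤ 0 := by
  have h1 := resolvent_sub_smul hR hl x
  simp only [yosida, neg_apply, smul_apply, inner_neg_left,
    inner_smul_left, conj_trivial]
  set y := resolvent R l x
  rw [← h1, inner_sub_right, inner_smul_right, real_inner_self_eq_norm_mul_norm, real_inner_comm]
  have h2 := mul_nonneg hl (neg_nonneg.2 (hR y))
  have : 0 ≤ ‖y‖ * ‖y‖ - l * inner ℝ (R y) y := by nlinarith [norm_nonneg y]
  nlinarith [mul_nonneg hl this]

/-- On the range, `n(1 - nR)⁻¹R w = (1 - nR)⁻¹w - w` has norm at most `2‖w‖`, which gives decay of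
order `1/n`. Density of the range and the uniform contraction bound extend this to all `x`. -/
theorem tendsto_resolvent (hR : ∀ x, inner ℝ (R x) x ≤ 0) (hinj : Function.Injective R) (x : X) :
    Tendsto (fun n : ℕ => resolvent R n x) atTop (𝓝 0) := by
  rw [Metric.tendsto_atTop]
  intro ε hε
  obtain ⟨w, hw⟩ := (denseRange R hR hinj).exists_dist_lt x (half_pos hε)
  obtain ⟨N, hN⟩ := exists_nat_gt (2 * ‖w‖ / (ε / 2))
  refine ⟨N + 1, fun n hn => ?_⟩
  have hn0 : (0 : ℝ) < n := by exact_mod_cast (by omega : 0 < n)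
  have hnN : (N : ℝ) ≤ n := by exact_mod_cast (by omega : N ≤ n)
  have h1 : ‖resolvent R n (R w)‖ ≤ 2 * ‖w‖ / n := by
    rw [le_div_iff₀ hn0]
    have h := resolvent_apply_sub hR hn0.le w
    have h' : (n : ℝ) • resolvent R n (R w) = resolvent R n w - w := by
      nth_rewrite 3 [← h]; abel
    calc ‖resolvent R n (R w)‖ * n = ‖(n : ℝ) • resolvent R n (R w)‖ := by
          rw [norm_smul, Real.norm_of_nonneg hn0.le, mul_comm]
      _ ≤ ‖resolvent R n w‖ + ‖w‖ := by rw [h']; exact norm_sub_le _ _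
      _ ≤ 2 * ‖w‖ := by linarith [norm_resolvent_le hR hn0.le w]
  have h2 : 2 * ‖w‖ / n < ε / 2 := by
    rw [div_lt_iff₀ (half_pos hε)] at hN
    rw [div_lt_iff₀ hn0]
    nlinarith
  have h3 : ‖resolvent R n (x - R w)‖ ≤ ‖x - R w‖ := norm_resolvent_le hR hn0.le _
  rw [dist_eq_norm] at hw
  rw [dist_zero_right]
  calc ‖resolvent R n x‖ = ‖resolvent R n (x - R w) + resolvent R n (R w)‖ := by
        rw [← map_add, sub_add_cancel]
    _ ≤ _ := norm_add_le _ _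
    _ < ε := by linarith

theorem tendsto_yosida (hR : ∀ x, inner ℝ (R x) x ≤ 0) (hinj : Function.Injective R) (y : X) :
    Tendsto (fun n : ℕ => yosida R n (R y)) atTop (𝓝 y) := by
  have h := (tendsto_resolvent hR hinj y).const_sub y
  rw [sub_zero] at h
  exact h.congr fun n => (yosida_apply_range hR n.cast_nonneg y).symm

end

/-! ### The exponential of a bounded dissipative operator -/

section Exp

variable [CompleteSpace X] {B C : X →L[ℝ] X}

theorem hasDerivAt_exp_smul_apply (B : X →L[ℝ] X) (t : ℝ) (x : X) :
    HasDerivAt (fun s : ℝ => NormedSpace.exp (s • B) x) (B (NormedSpace.exp (t • B) x)) t := by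
  have h := hasDerivAt_exp_smul_const' (𝕂 := ℝ) B t
  exact h.clm_apply (hasDerivAt_const t x) |>.congr_deriv (by simp)

/-- The derivative of `‖exp(sB)x‖²` is twice `⟨B y, y⟩` at `y = exp(sB)x`, so the norm decreases. -/
theorem norm_exp_smul_apply_le (hB : ∀ x, inner ℝ (B x) x ≤ 0) {t : ℝ} (ht : 0 ≤ t) (x : X) :
    ‖NormedSpace.exp (t • B) x‖ ≤ ‖x‖ := by
  have hd : ∀ s : ℝ, HasDerivAt (fun s : ℝ => ‖NormedSpace.exp (s • B) x‖ ^ 2)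
      (2 * inner ℝ (NormedSpace.exp (s • B) x) (B (NormedSpace.exp (s • B) x))) s := fun s =>
    (hasDerivAt_exp_smul_apply B s x).norm_sq
  have hanti : Antitone fun s : ℝ => ‖NormedSpace.exp (s • B) x‖ ^ 2 := by
    refine antitone_of_deriv_nonpos (fun s => (hd s).differentiableAt) fun s => ?_
    rw [(hd s).deriv, real_inner_comm]
    linarith [hB (NormedSpace.exp (s • B) x)]
  have h := hanti ht
  simp only [zero_smul, NormedSpace.exp_zero, one_apply_eq_self] at h
  exact (pow_le_pow_iff_left₀ (norm_nonneg _) (norm_nonneg _) two_ne_zero).1 h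

/-- The path `s ↦ exp(sB) exp((t - s)C) x` joins the two exponentials. By commutation its velocity
is a product of contractions applied to `B x - C x`. -/
theorem norm_exp_smul_sub_exp_smul_le (hB : ∀ x, inner ℝ (B x) x ≤ 0)
    (hC : ∀ x, inner ℝ (C x) x ≤ 0) (h : Commute B C) {t : ℝ} (ht : 0 ≤ t) (x : X) :
    ‖NormedSpace.exp (t • B) x - NormedSpace.exp (t • C) x‖ ≤ t * ‖B x - C x‖ := by
  let f : ℝ → X := fun s => NormedSpace.exp (s • B) (NormedSpace.exp ((t - s) • C) x)
  have hd : ∀ s : ℝ, HasDerivAt f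
      (NormedSpace.exp (s • B) (NormedSpace.exp ((t - s) • C) (B x - C x))) s := by
    intro s
    have h1 := hasDerivAt_exp_smul_const (𝕂 := ℝ) B s
    have h2 : HasDerivAt (fun s : ℝ => NormedSpace.exp ((t - s) • C) x)
        (-(C (NormedSpace.exp ((t - s) • C) x))) s := by
      have := (hasDerivAt_exp_smul_apply C (t - s) x).scomp s ((hasDerivAt_id s).const_sub t)
      simpa using! this
    refine (h1.clm_apply h2).congr_deriv ?_
    have c1 : Commute B (NormedSpace.exp ((t - s) • C)) := (h.smul_right _).exp_right
    have c2 : Commute C (NormedSpace.exp ((t - s) • C)) :=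
      ((Commute.refl C).smul_right _).exp_right
    have e1 : B (NormedSpace.exp ((t - s) • C) x) = NormedSpace.exp ((t - s) • C) (B x) :=
      congrArg (fun g : X →L[ℝ] X => g x) c1.eq
    have e2 : C (NormedSpace.exp ((t - s) • C) x) = NormedSpace.exp ((t - s) • C) (C x) :=
      congrArg (fun g : X →L[ℝ] X => g x) c2.eq
    rw [mul_apply_eq_comp, e1, e2, map_sub, map_sub, map_neg]
    abel
  have hb : ∀ s ∈ Ico 0 t, ‖NormedSpace.exp (s • B) (NormedSpace.exp ((t - s) • C) (B x - C x))‖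
      ≤ ‖B x - C x‖ := fun s hs =>
    (norm_exp_smul_apply_le hB hs.1 _).trans (norm_exp_smul_apply_le hC (by linarith [hs.2]) _)
  have := norm_image_sub_le_of_norm_deriv_le_segment' (fun s _ => (hd s).hasDerivWithinAt) hb t
    ⟨ht, le_rfl⟩
  simpa [f, mul_comm] using this

theorem norm_exp_smul_sub_self_le (hB : ∀ x, inner ℝ (B x) x ≤ 0) {t : ℝ} (ht : 0 ≤ t) (x : X) :
    ‖NormedSpace.exp (t • B) x - x‖ ≤ t * ‖B x‖ := by
  have := norm_exp_smul_sub_exp_smul_le hB (C := 0) (by simp) (Commute.zero_right B) ht x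
  simpa using this

/-- Intended for `B` a Yosida approximation, `x = R w` and `y = w`. Since `B w` need not stay
bounded, `w` is replaced by a nearby `v` in the range of `R`, where `B v` converges. -/
theorem norm_exp_smul_sub_sub_smul_le (hB : ∀ x, inner ℝ (B x) x ≤ 0) {t : ℝ} (ht : 0 ≤ t)
    (x y v : X) :
    ‖NormedSpace.exp (t • B) x - x - t • y‖ ≤ t * (‖B x - y‖ + 2 * ‖y - v‖ + t * ‖B v‖) := by
  let f : ℝ → X := fun s => NormedSpace.exp (s • B) x - x - s • y
  have hd : ∀ s : ℝ, HasDerivAt f (NormedSpace.exp (s • B) (B x) - y) s := by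
    intro s
    have h1 := hasDerivAt_exp_smul_const (𝕂 := ℝ) B s
    have h2 := ((h1.clm_apply (hasDerivAt_const s x)).sub_const x).sub
      ((hasDerivAt_id s).smul_const y)
    exact h2.congr_deriv (by simp)
  have hb : ∀ s ∈ Ico 0 t, ‖NormedSpace.exp (s • B) (B x) - y‖
      ≤ ‖B x - y‖ + 2 * ‖y - v‖ + t * ‖B v‖ := by
    intro s hs
    have e : NormedSpace.exp (s • B) (B x) - y = NormedSpace.exp (s • B) (B x - y) +
        NormedSpace.exp (s • B) (y - v) + (NormedSpace.exp (s • B) v - v) - (y - v) := by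
      simp only [map_sub]; abel
    have h1 := norm_exp_smul_apply_le hB hs.1 (B x - y)
    have h2 := norm_exp_smul_apply_le hB hs.1 (y - v)
    have h3 := norm_exp_smul_sub_self_le hB hs.1 v
    have h4 : s * ‖B v‖ ≤ t * ‖B v‖ := mul_le_mul_of_nonneg_right hs.2.le (norm_nonneg _)
    rw [e]
    refine (norm_sub_le _ _).trans ?_
    linarith [norm_add₃_le (a := NormedSpace.exp (s • B) (B x - y))
      (b := NormedSpace.exp (s • B) (y - v)) (c := NormedSpace.exp (s • B) v - v)]
  have := norm_image_sub_le_of_norm_deriv_le_segment' (fun s _ => (hd s).hasDerivWithinAt) hb t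
    ⟨ht, le_rfl⟩
  simpa [f, mul_comm] using this

end Exp

end Dissipative

/-! ### The semigroup generated by the inverse of a bounded dissipative operator -/

namespace Dissipative

variable {X : Type*} [NormedAddCommGroup X] [InnerProductSpace ℝ X] [CompleteSpace X]
  {R : X →L[ℝ] X}

/-- On the range of `R` the difference of two exponentials is controlled by that of the
approximations, which converge there. Elsewhere, approximate by the dense range and use
contractivity. -/
theorem cauchySeq_exp_yosida (hR : ∀ x, inner ℝ (R x) x ≤ 0) (hinj : Function.Injective R)
    {t : ℝ} (ht : 0 ≤ t) (x : X) :
    CauchySeq fun n : ℕ => NormedSpace.exp (t • yosida R n) x := by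
  rw [Metric.cauchySeq_iff]
  intro ε hε
  obtain ⟨w, hw⟩ := (denseRange R hR hinj).exists_dist_lt x (by positivity : 0 < ε / 4)
  have hc := (tendsto_yosida hR hinj w).cauchySeq
  obtain ⟨N, hN⟩ := Metric.cauchySeq_iff.1 hc (ε / (2 * (t + 1))) (by positivity)
  refine ⟨N, fun m hm n hn => ?_⟩
  have hdm := inner_yosida_nonpos hR (Nat.cast_nonneg (α := ℝ) m)
  have hdn := inner_yosida_nonpos hR (Nat.cast_nonneg (α := ℝ) n)
  have h1 := norm_exp_smul_sub_exp_smul_le hdm hdn (commute_yosida R m n) ht (R w)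
  have h2 := hN m hm n hn
  rw [dist_eq_norm] at h2 hw ⊢
  have h3 : t * ‖yosida R m (R w) - yosida R n (R w)‖ ≤ ε / 2 := by
    have : t * ‖yosida R m (R w) - yosida R n (R w)‖ ≤ (t + 1) * (ε / (2 * (t + 1))) :=
      mul_le_mul (by linarith) h2.le (norm_nonneg _) (by linarith)
    refine this.trans_eq ?_
    field_simp
  have h4 := norm_exp_smul_apply_le hdm ht (x - R w)
  have h5 := norm_exp_smul_apply_le hdn ht (x - R w)
  have e : NormedSpace.exp (t • yosida R m) x - NormedSpace.exp (t • yosida R n) x =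
      NormedSpace.exp (t • yosida R m) (x - R w) - NormedSpace.exp (t • yosida R n) (x - R w) +
      (NormedSpace.exp (t • yosida R m) (R w) - NormedSpace.exp (t • yosida R n) (R w)) := by
    simp only [map_sub]; abel
  rw [e]
  refine (norm_add_le _ _).trans_lt ?_
  have := norm_sub_le (NormedSpace.exp (t • yosida R m) (x - R w))
    (NormedSpace.exp (t • yosida R n) (x - R w))
  linarith

theorem exists_tendsto_exp_yosida (hR : ∀ x, inner ℝ (R x) x ≤ 0) (hinj : Function.Injective R) :
    ∃ T : ℝ≥0 → X →L[ℝ] X, ∀ (t : ℝ≥0) x,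
      Tendsto (fun n : ℕ => NormedSpace.exp ((t : ℝ) • yosida R n) x) atTop (𝓝 (T t x)) := by
  choose T hT using fun (t : ℝ≥0) x =>
    cauchySeq_tendsto_of_complete (cauchySeq_exp_yosida hR hinj t.2 x)
  exact ⟨fun t => continuousLinearMapOfTendsto (fun n : ℕ => NormedSpace.exp ((t : ℝ) • yosida R n))
    (tendsto_pi_nhds.2 (hT t)), hT⟩

/-- If `R` is bounded, injective and dissipative, then `R⁻¹` generates a contraction semigroup. -/
theorem exists_contraction_semigroup (hR : ∀ x, inner ℝ (R x) x ≤ 0)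
    (hinj : Function.Injective R) :
    ∃ T : C0Semigroup X, T.IsContraction ∧ ∀ w, Tendsto
      (fun t : ℝ≥0 => (t : ℝ)⁻¹ • (T.toFun t (R w) - R w)) (𝓝[>] 0) (𝓝 w) := by
  obtain ⟨T, hT⟩ := exists_tendsto_exp_yosida hR hinj
  have hd : ∀ n : ℕ, ∀ x, inner ℝ (yosida R n x) x ≤ 0 := fun n =>
    inner_yosida_nonpos hR n.cast_nonneg
  have hnorm : ∀ t x, ‖T t x‖ ≤ ‖x‖ := fun t x =>
    le_of_tendsto' (hT t x).norm fun n => norm_exp_smul_apply_le (hd n) t.2 x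
  -- The error bound survives `n → ∞`, where the approximations applied to `R w` and `R v` tend to
  -- `w` and `v`.
  have hsub : ∀ (t : ℝ≥0) w v, ‖T t (R w) - R w - (t : ℝ) • w‖ ≤
      t * (2 * ‖w - R v‖ + t * ‖v‖) := by
    intro t w v
    have h1 := (((hT t (R w)).sub_const (R w)).sub_const ((t : ℝ) • w)).norm
    have h2 := ((((tendsto_yosida hR hinj w).sub_const w).norm.add_const (2 * ‖w - R v‖)).add
      ((tendsto_yosida hR hinj v).norm.const_mul (t : ℝ))).const_mul (t : ℝ)
    rw [sub_self, norm_zero, zero_add] at h2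
    exact le_of_tendsto_of_tendsto' h1 h2 fun n =>
      norm_exp_smul_sub_sub_smul_le (hd n) t.2 (R w) w (R v)
  have hgen : ∀ w, Tendsto (fun t : ℝ≥0 => (t : ℝ)⁻¹ • (T t (R w) - R w)) (𝓝[>] 0) (𝓝 w) := by
    intro w
    rw [Metric.tendsto_nhds]
    intro ε hε
    obtain ⟨v, hv⟩ := (denseRange R hR hinj).exists_dist_lt w (by positivity : 0 < ε / 4)
    rw [dist_eq_norm] at hv
    have h0 : Tendsto (fun t : ℝ≥0 => (t : ℝ) * ‖v‖) (𝓝[>] 0) (𝓝 0) := by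
      have : Tendsto (fun t : ℝ≥0 => (t : ℝ) * ‖v‖) (𝓝 0) (𝓝 (((0 : ℝ≥0) : ℝ) * ‖v‖)) :=
        (NNReal.continuous_coe.mul continuous_const).tendsto 0
      rw [NNReal.coe_zero, zero_mul] at this
      exact this.mono_left nhdsWithin_le_nhds
    filter_upwards [h0.eventually_lt_const (half_pos hε), self_mem_nhdsWithin] with t ht htpos
    have ht0 : (0 : ℝ) < t := NNReal.coe_pos.2 htpos
    have e : (t : ℝ)⁻¹ • (T t (R w) - R w) - w =
        (t : ℝ)⁻¹ • (T t (R w) - R w - (t : ℝ) • w) := by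
      rw [smul_sub _ _ ((t : ℝ) • w), smul_smul, inv_mul_cancel₀ ht0.ne', one_smul]
    rw [dist_eq_norm, e, norm_smul, norm_inv, Real.norm_of_nonneg ht0.le,
      inv_mul_lt_iff₀ ht0]
    refine (hsub t w v).trans_lt (mul_lt_mul_of_pos_left ?_ ht0)
    linarith
  have hzero : T 0 = ContinuousLinearMap.id ℝ X := by
    ext x
    refine tendsto_nhds_unique (hT 0 x) ?_
    simp
  have hadd : ∀ s t, T (s + t) = (T s).comp (T t) := by
    intro s t
    ext x
    refine tendsto_nhds_unique (hT (s + t) x) ?_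
    have h1 := hT s (T t x)
    -- Contractivity, uniform in `n`, allows the inner exponential to be replaced by its limit `T t
    -- x`.
    have h2 : Tendsto (fun n : ℕ => NormedSpace.exp ((s : ℝ) • yosida R n)
        (NormedSpace.exp ((t : ℝ) • yosida R n) x - T t x)) atTop (𝓝 0) := by
      refine squeeze_zero_norm (fun n => norm_exp_smul_apply_le (hd n) s.2 _) ?_
      have := ((hT t x).sub_const (T t x)).norm
      rwa [sub_self, norm_zero] at this
    have h3 := h2.add h1
    rw [zero_add] at h3
    refine h3.congr fun n => ?_
    have hc : Commute ((s : ℝ) • yosida R n) ((t : ℝ) • yosida R n) :=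
      ((Commute.refl (yosida R n)).smul_left _).smul_right _
    let _ : NormedAlgebra ℚ (X →L[ℝ] X) := .restrictScalars ℚ ℝ _
    rw [NNReal.coe_add, add_smul, NormedSpace.exp_add_of_commute hc, mul_apply_eq_comp, map_sub,
      sub_add_cancel]
  have hcont : ∀ x, Tendsto (fun t => T t x) (𝓝 0) (𝓝 x) := by
    intro x
    rw [Metric.tendsto_nhds]
    intro ε hε
    obtain ⟨w, hw⟩ := (denseRange R hR hinj).exists_dist_lt x (by positivity : 0 < ε / 4)
    rw [dist_eq_norm] at hw
    have h0 : Tendsto (fun t : ℝ≥0 => (t : ℝ) * ‖w‖ + (t : ℝ) * (2 * ‖w - R 0‖ + t * ‖(0 : X)‖))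
        (𝓝 0) (𝓝 0) := by
      have : Continuous fun t : ℝ≥0 =>
          (t : ℝ) * ‖w‖ + (t : ℝ) * (2 * ‖w - R 0‖ + t * ‖(0 : X)‖) := by fun_prop
      simpa using this.tendsto 0
    filter_upwards [h0.eventually_lt_const (half_pos hε)] with t ht
    have e : T t x - x = T t (x - R w) + (T t (R w) - R w - (t : ℝ) • w) + (t : ℝ) • w
        - (x - R w) := by
      simp only [map_sub]; abel
    rw [dist_eq_norm, e]
    refine (norm_sub_le _ _).trans_lt ?_
    have h1 := norm_add₃_le (a := T t (x - R w)) (b := T t (R w) - R w - (t : ℝ) • w)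
      (c := (t : ℝ) • w)
    have h2 : ‖(t : ℝ) • w‖ = t * ‖w‖ := by rw [norm_smul, Real.norm_of_nonneg t.coe_nonneg]
    linarith [hnorm t (x - R w), hsub t w 0]
  exact ⟨⟨T, hzero, hadd, hcont⟩, fun t =>
    ContinuousLinearMap.opNorm_le_bound _ zero_le_one fun x => by simpa using hnorm t x, hgen⟩

end Dissipative

/-- **Lumer–Phillips theorem** for an invertible operator on a Hilbert space: a dissipative
bijection `A : D(A) → X` generates a contraction semigroup. -/
theorem LinearPMap.exists_contraction_semigroup_of_dissipative {X : Type*} [NormedAddCommGroup X]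
    [InnerProductSpace ℝ X] [CompleteSpace X] (A : X →ₗ.[ℝ] X)
    (hA : ∀ z : A.domain, inner ℝ (A z) (z : X) ≤ 0) (hbij : Function.Bijective A.toFun) :
    ∃ T : C0Semigroup X, T.IsContraction ∧ T.IsGeneratedBy A := by
  let e := LinearEquiv.ofBijective A.toFun hbij
  let R₀ : X →ₗ[ℝ] X := A.domain.subtype.comp e.symm.toLinearMap
  have he : ∀ x, A (e.symm x) = x := fun x => e.apply_symm_apply x
  have hR₀ : ∀ x, inner ℝ (R₀ x) x ≤ 0 := fun x => by
    have := hA (e.symm x)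
    rwa [he, real_inner_comm] at this
  let R : X →L[ℝ] X := ⟨R₀, Dissipative.continuous_of_inner_self_nonpos R₀ hR₀⟩
  have hR : ∀ x, inner ℝ (R x) x ≤ 0 := hR₀
  have hinj : Function.Injective R :=
    A.domain.injective_subtype.comp e.symm.injective
  obtain ⟨T, hT, hgen⟩ := Dissipative.exists_contraction_semigroup hR hinj
  refine ⟨T, hT, fun z w => ?_⟩
  have hgraph : (z, w) ∈ A.graph ↔ z = R w := by
    rw [LinearPMap.mem_graph_iff]
    constructor
    · rintro ⟨y, hy, hyw⟩
      have : e.symm w = y := by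
        rw [LinearEquiv.symm_apply_eq]; exact hyw.symm
      subst this
      exact hy.symm
    · rintro rfl
      exact ⟨e.symm w, rfl, he w⟩
  rw [hgraph]
  refine ⟨fun h => h ▸ hgen w, fun h => ?_⟩
  -- Maximality: the generator is dissipative and already extends the surjective `A`. It sends `z -
  -- R w + s • R x` to `s • x`; dissipativity for all `s` forces `z - R w` to be orthogonal to every
  -- `x`.
  rw [← sub_eq_zero]
  refine ext_inner_right ℝ fun x => ?_
  rw [inner_zero_left]
  refine eq_zero_of_forall_mul_add_sq_mul_nonpos (c := inner ℝ (R x) x) fun s => ?_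
  have h1 := (h.sub (hgen w)).add ((hgen x).const_smul s)
  rw [sub_self, zero_add] at h1
  have h2 := h1.inner (𝕜 := ℝ)
    (tendsto_const_nhds : Tendsto (fun _ : ℝ≥0 => z - R w + s • R x) (𝓝[>] 0) (𝓝 _))
  have h3 : inner ℝ (s • x) (z - R w + s • R x) ≤ 0 := by
    refine le_of_tendsto h2 ?_
    filter_upwards with t
    set u := z - R w + s • R x with hu
    have hb : ‖T.toFun t u‖ ≤ ‖u‖ := by
      simpa using (T.toFun t).le_of_opNorm_le (hT t) u
    have e1 : (t : ℝ)⁻¹ • (T.toFun t z - z) - (t : ℝ)⁻¹ • (T.toFun t (R w) - R w) +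
        s • ((t : ℝ)⁻¹ • (T.toFun t (R x) - R x)) = (t : ℝ)⁻¹ • (T.toFun t u - u) := by
      have hTu : T.toFun t u = T.toFun t z - T.toFun t (R w) + s • T.toFun t (R x) := by
        rw [hu, (T.toFun t).map_add, (T.toFun t).map_sub, (T.toFun t).map_smul]
      rw [hTu, hu]
      module
    rw [e1, inner_smul_left, conj_trivial]
    refine mul_nonpos_of_nonneg_of_nonpos (inv_nonneg.2 t.2) ?_
    rw [inner_sub_left, real_inner_self_eq_norm_mul_norm]
    nlinarith [real_inner_le_norm (T.toFun t u) u, norm_nonneg u]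
  rw [inner_smul_left, inner_add_right, inner_smul_right, conj_trivial, real_inner_comm,
    real_inner_comm (R x) x] at h3
  linarith

/-- Difference of squares: the quotient is the inner product of `(T(t)z - z)/t` with `(T(t)z +
z)/2`, and the second factor tends to `z`. -/
theorem C0Semigroup.tendsto_half_inner_self {X : Type*} [NormedAddCommGroup X]
    [InnerProductSpace ℝ X] (T : C0Semigroup X) {z w : X}
    (h : Tendsto (fun t : ℝ≥0 => (t : ℝ)⁻¹ • (T.toFun t z - z)) (𝓝[>] 0) (𝓝 w)) :
    Tendsto (fun t : ℝ≥0 => (1 / 2 * inner ℝ (T.toFun t z) (T.toFun t z) -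
      1 / 2 * inner ℝ z z) / (t : ℝ)) (𝓝[>] 0) (𝓝 (inner ℝ w z)) := by
  have h1 : Tendsto (fun t => (1 / 2 : ℝ) • (T.toFun t z + z)) (𝓝[>] 0)
      (𝓝 ((1 / 2 : ℝ) • (z + z))) :=
    (((T.tendsto_zero z).mono_left nhdsWithin_le_nhds).add_const z).const_smul _
  have h2 : (1 / 2 : ℝ) • (z + z) = z := by
    rw [← two_smul ℝ z, smul_smul]; norm_num
  rw [h2] at h1
  refine (h.inner h1).congr fun t => ?_
  rw [inner_smul_left, inner_smul_right, inner_sub_left, inner_add_right, inner_add_right,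
    conj_trivial, real_inner_comm z]
  ring

/-! ### Primitives on `[0, L]` -/

theorem AbsolutelyContinuousOnInterval.eq_of_deriv_ae_eq_zero {u : ℝ → ℝ} {L : ℝ}
    (hu : AbsolutelyContinuousOnInterval u 0 L)
    (h : deriv u =ᵐ[volume.restrict (Icc 0 L)] 0) {x y : ℝ} (hx : x ∈ Icc 0 L)
    (hy : y ∈ Icc 0 L) : u x = u y := by
  have hL : 0 ≤ L := hx.1.trans hx.2
  have hxy : uIcc y x ⊆ Icc 0 L := uIcc_subset_Icc hy hx
  rw [← sub_eq_zero, ← (hu.mono (by rwa [uIcc_of_le hL])).integral_deriv_eq_sub]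
  refine intervalIntegral.integral_zero_ae ?_
  filter_upwards [(ae_restrict_iff' measurableSet_Icc).1 h] with t ht ht'
  exact ht (hxy (uIoc_subset_uIcc ht'))

/-- The base point `c` is free because the beam equations are integrated from both ends. -/
theorem exists_primitive {L : ℝ} (hL : 0 < L) {g : ℝ → ℝ}
    (hg : MemLp g 2 (volume.restrict (Icc 0 L))) {c : ℝ} (hc : c ∈ Icc 0 L) (a : ℝ) :
    ∃ u, IsH1Rep L u u ∧ deriv u =ᵐ[volume.restrict (Icc 0 L)] g ∧ u c = a := by
  have hi : IntervalIntegrable g volume 0 L := by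
    rw [intervalIntegrable_iff_integrableOn_Icc_of_le hL.le]
    exact hg.integrable one_le_two
  have hac := hi.absolutelyContinuousOnInterval_intervalIntegral (c := c)
    (by rwa [uIcc_of_le hL.le])
  have hconst : AbsolutelyContinuousOnInterval (fun _ : ℝ => a) 0 L :=
    (LipschitzWith.const a).lipschitzOnWith.absolutelyContinuousOnInterval
  have hd : deriv (fun x => a + ∫ t in c..x, g t) =ᵐ[volume.restrict (Icc 0 L)] g := by
    refine (ae_restrict_iff' measurableSet_Icc).2 ?_
    filter_upwards [hi.ae_hasDerivAt_integral] with x hx hx'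
    rw [uIcc_of_le hL.le] at hx
    exact ((hx hx' c hc).const_add a).deriv
  exact ⟨_, ⟨EventuallyEq.rfl, hconst.add hac, (memLp_congr_ae hd).2 hg⟩, hd, by simp⟩

namespace TimoshenkoBeam

variable {b : TimoshenkoBeam}

/-! ### Completeness of the state space -/

theorem exists_bound_of_continuousOn {f : Fin 4 → ℝ → ℝ}
    (hf : ∀ i, ContinuousOn (f i) (Icc 0 b.L)) :
    ∃ C, 0 ≤ C ∧ ∀ ξ ∈ Icc 0 b.L, ∀ i, f i ξ ≤ C := by
  obtain ⟨C, hC⟩ := isCompact_Icc.exists_bound_of_continuousOn (continuousOn_pi.2 hf)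
  exact ⟨C, (norm_nonneg _).trans (hC 0 ⟨le_rfl, b.L_pos.le⟩), fun ξ hξ i =>
    (le_abs_self _).trans ((norm_le_pi_norm (fun i => f i ξ) i).trans (hC ξ hξ))⟩

theorem inner_eq_energyInner (z w : b.Z) : inner ℝ z w = energyInner z w := rfl

theorem norm_toL2_sq (z : b.Z) : ‖b.toL2 z‖ ^ 2 = ∫ ξ, ∑ i, comp z ξ i ^ 2 ∂b.μ := by
  rw [← real_inner_self_eq_norm_sq, L2.inner_def]
  refine integral_congr_ae (Eventually.of_forall fun ξ => ?_)
  simp only [real_inner_self_eq_norm_sq, EuclideanSpace.real_norm_sq_eq]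
  rfl

theorem norm_sq_eq (z : b.Z) : ‖z‖ ^ 2 = ∫ ξ, ∑ i, b.h ξ i * comp z ξ i ^ 2 ∂b.μ := by
  rw [← real_inner_self_eq_norm_sq, inner_eq_energyInner, energyInner_eq]
  congr 1 with ξ
  exact Finset.sum_congr rfl fun i _ => by ring

theorem integrable_sum_comp_sq (z : b.Z) : Integrable (fun ξ => ∑ i, comp z ξ i ^ 2) b.μ :=
  integrable_finsetSum _ fun i _ => (memLp_comp z i).integrable_sq

theorem integrable_sum_h_mul_comp_sq (z : b.Z) :
    Integrable (fun ξ => ∑ i, b.h ξ i * comp z ξ i ^ 2) b.μ := by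
  refine (integrable_energy z z).congr (Eventually.of_forall fun ξ => ?_)
  exact Finset.sum_congr rfl fun i _ => by ring

theorem norm_le_sqrt_mul {E F : Type*} [SeminormedAddCommGroup E] [SeminormedAddCommGroup F]
    {x : E} {y : F} {C : ℝ} (hC : 0 ≤ C) (h : ‖x‖ ^ 2 ≤ C * ‖y‖ ^ 2) : ‖x‖ ≤ √C * ‖y‖ := by
  rw [← Real.sqrt_sq (norm_nonneg y), ← Real.sqrt_mul hC]
  exact Real.le_sqrt_of_sq_le h

theorem exists_norm_le_norm_toL2 : ∃ C : ℝ, ∀ z : b.Z, ‖z‖ ≤ C * ‖b.toL2 z‖ := by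
  obtain ⟨C, hC0, hC⟩ := exists_bound_of_continuousOn (b := b) continuousOn_h
  refine ⟨√C, fun z => norm_le_sqrt_mul hC0 ?_⟩
  rw [norm_toL2_sq, norm_sq_eq, ← integral_const_mul]
  refine integral_mono_ae (integrable_sum_h_mul_comp_sq z)
    ((integrable_sum_comp_sq z).const_mul C) ?_
  filter_upwards [ae_restrict_mem measurableSet_Icc] with ξ hξ
  rw [Finset.mul_sum]
  exact Finset.sum_le_sum fun i _ => mul_le_mul_of_nonneg_right (hC ξ hξ i) (sq_nonneg _)

theorem exists_norm_toL2_le_norm : ∃ C : ℝ, ∀ z : b.Z, ‖b.toL2 z‖ ≤ C * ‖z‖ := by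
  obtain ⟨C, hC0, hC⟩ := exists_bound_of_continuousOn (b := b) (f := fun i ξ => (b.h ξ i)⁻¹)
    fun i => (continuousOn_h i).inv₀ fun ξ hξ => (h_pos hξ i).ne'
  refine ⟨√C, fun z => norm_le_sqrt_mul hC0 ?_⟩
  rw [norm_toL2_sq, norm_sq_eq, ← integral_const_mul]
  refine integral_mono_ae (integrable_sum_comp_sq z)
    ((integrable_sum_h_mul_comp_sq z).const_mul C) ?_
  filter_upwards [ae_restrict_mem measurableSet_Icc] with ξ hξ
  rw [Finset.mul_sum]
  refine Finset.sum_le_sum fun i _ => ?_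
  have h1 : 1 ≤ C * b.h ξ i := by
    have := mul_le_mul_of_nonneg_right (hC ξ hξ i) (h_pos hξ i).le
    rwa [inv_mul_cancel₀ (h_pos hξ i).ne'] at this
  rw [← mul_assoc]
  exact le_mul_of_one_le_left (sq_nonneg _) h1

/-- The diagonal of `ℋ` is continuous and positive on a compact interval, so it lies between
positive constants and the energy norm is equivalent to the `L²` norm. -/
instance : CompleteSpace b.Z := by
  obtain ⟨C, hC⟩ := exists_norm_toL2_le_norm (b := b)
  obtain ⟨D, hD⟩ := exists_norm_le_norm_toL2 (b := b)
  let e := b.toL2.toContinuousLinearEquivOfBounds C D hC fun x => by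
    simpa using hD (b.toL2.symm x)
  exact (completeSpace_congr (e := e.toEquiv) e.isUniformEmbedding).2 inferInstance

/-! ### The operator `𝒥` in components -/

theorem coenergy_apply (z : b.Z) (i : Fin 4) (ξ : ℝ) :
    coenergy z i ξ = b.h ξ i * comp z ξ i := by
  simp [coenergy, H, Matrix.mulVec_diagonal]

theorem JFun_apply (z : b.Z) (ξ : ℝ) : (JFun z ξ : Fin 4 → ℝ) =
    ![deriv (coenergyRep z 2) ξ - b.γ ξ * coenergyRep z 0 ξ,
      deriv (coenergyRep z 3) ξ + coenergyRep z 2 ξ - b.δ ξ * coenergyRep z 1 ξ,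
      deriv (coenergyRep z 0) ξ - coenergyRep z 1 ξ,
      deriv (coenergyRep z 1) ξ] := by
  ext i
  simp only [JFun, Pi.add_apply, Matrix.mulVec, dotProduct, Fin.sum_univ_four, Matrix.sub_apply,
    G₀, Matrix.diagonal_apply]
  fin_cases i <;> simp [P₁, P₀] <;> ring

theorem comp_J (z : b.J.domain) :
    comp (b.J z) =ᵐ[b.μ] fun ξ => (JFun (z : b.Z) ξ : Fin 4 → ℝ) := by
  filter_upwards [(memLp_JFun z.2).coeFn_toLp] with ξ hξ
  ext i
  exact congrArg (fun v : EuclideanSpace ℝ (Fin 4) => v i) hξ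

theorem coenergyRep_bdry {z : b.Z} (hz : z ∈ b.domJ) :
    coenergyRep z 0 0 = 0 ∧ coenergyRep z 1 0 = 0 ∧
      coenergyRep z 2 b.L = -(b.γ b.L * coenergyRep z 0 b.L) ∧
      coenergyRep z 3 b.L = -(b.δ b.L * coenergyRep z 1 b.L) := by
  have h1 := hz.2.1
  have h2 := hz.2.2
  refine ⟨congrFun h1 0, congrFun h1 1, ?_, ?_⟩
  · simpa [B₂, C₂, S, Matrix.mulVec_diagonal] using congrFun h2 0
  · simpa [B₂, C₂, S, Matrix.mulVec_diagonal] using congrFun h2 1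

/-! ### Dissipation of energy -/

theorem inner_J (z : b.J.domain) :
    inner ℝ (b.J z) (z : b.Z) =
      -(∫ ξ in 0..b.L,
          (b.γ ξ / b.ρ ξ ^ 2 * comp (z : b.Z) ξ 0 ^ 2 +
            b.δ ξ / b.Iρ ξ ^ 2 * comp (z : b.Z) ξ 1 ^ 2)) -
        C₂ (z : b.Z) ⬝ᵥ (b.S b.L *ᵥ C₂ (z : b.Z)) := by
  set u := coenergyRep (z : b.Z) with hu
  have hr : ∀ i, IsH1Rep b.L (coenergy (z : b.Z) i) (u i) := fun i => (z.2.1 i).isH1Rep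
  have hc : ∀ i, ContinuousOn (u i) (uIcc 0 b.L) := fun i => (hr i).ac.continuousOn
  have hae : ∀ᵐ ξ ∂b.μ, ∀ i, b.h ξ i * comp (z : b.Z) ξ i = u i ξ := ae_all_iff.2 fun i => by
    filter_upwards [(hr i).ae_eq] with ξ hξ
    rw [← hξ, coenergy_apply]
  have hdamp : ∫ ξ in 0..b.L, (b.γ ξ / b.ρ ξ ^ 2 * comp (z : b.Z) ξ 0 ^ 2 +
      b.δ ξ / b.Iρ ξ ^ 2 * comp (z : b.Z) ξ 1 ^ 2) =
      ∫ ξ in 0..b.L, (b.γ ξ * u 0 ξ ^ 2 + b.δ ξ * u 1 ξ ^ 2) := by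
    refine intervalIntegral.integral_congr_ae ?_
    filter_upwards [(ae_restrict_iff' measurableSet_Icc).1 hae] with ξ hξ hξ'
    rw [uIoc_of_le b.L_pos.le] at hξ'
    have h := hξ (Ioc_subset_Icc_self hξ')
    rw [← h 0, ← h 1]
    simp only [TimoshenkoBeam.h, Matrix.cons_val_zero, Matrix.cons_val_one]
    ring
  -- The weight is absorbed into `u`, the two `P₀` terms cancel, and the derivatives pair into those
  -- of `u 0 * u 2` and `u 1 * u 3`.
  have hinner : inner ℝ (b.J z) (z : b.Z) = ∫ ξ in 0..b.L,
      ((deriv (u 0) ξ * u 2 ξ + u 0 ξ * deriv (u 2) ξ) +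
        (deriv (u 1) ξ * u 3 ξ + u 1 ξ * deriv (u 3) ξ)) -
        (b.γ ξ * u 0 ξ ^ 2 + b.δ ξ * u 1 ξ ^ 2) := by
    rw [inner_eq_energyInner, energyInner_eq, intervalIntegral.integral_of_le b.L_pos.le,
      ← integral_Icc_eq_integral_Ioc]
    refine integral_congr_ae ?_
    filter_upwards [hae, comp_J z] with ξ h1 h2
    rw [h2, JFun_apply]
    simp only [h1, Fin.sum_univ_four, ← hu]
    simp
    ring
  have hprod : ∀ i j, IntervalIntegrable (fun ξ => deriv (u i) ξ * u j ξ + u i ξ * deriv (u j) ξ)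
      volume 0 b.L := fun i j =>
    ((hr i).ac.intervalIntegrable_deriv.mul_continuousOn (hc j)).add
      ((hr j).ac.intervalIntegrable_deriv.continuousOn_mul (hc i))
  have hq : IntervalIntegrable (fun ξ => b.γ ξ * u 0 ξ ^ 2 + b.δ ξ * u 1 ξ ^ 2) volume 0 b.L :=
    ((b.γ_ac.continuousOn.mul ((hc 0).pow 2)).add
      (b.δ_ac.continuousOn.mul ((hc 1).pow 2))).intervalIntegrable
  rw [hinner, hdamp, intervalIntegral.integral_sub ((hprod 0 2).add (hprod 1 3)) hq,
    intervalIntegral.integral_add (hprod 0 2) (hprod 1 3),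
    (hr 0).ac.integral_deriv_mul_eq_sub (hr 2).ac, (hr 1).ac.integral_deriv_mul_eq_sub (hr 3).ac]
  obtain ⟨h1, h2, h3, h4⟩ := coenergyRep_bdry z.2
  rw [← hu] at h1 h2 h3 h4
  simp only [C₂, S, Matrix.mulVec_diagonal, dotProduct, Fin.sum_univ_two, ← hu, h1, h2, h3, h4,
    Matrix.cons_val_zero, Matrix.cons_val_one]
  ring

theorem inner_J_nonpos (z : b.J.domain) : inner ℝ (b.J z) (z : b.Z) ≤ 0 := by
  rw [inner_J]
  have h1 : 0 ≤ ∫ ξ in 0..b.L, (b.γ ξ / b.ρ ξ ^ 2 * comp (z : b.Z) ξ 0 ^ 2 +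
      b.δ ξ / b.Iρ ξ ^ 2 * comp (z : b.Z) ξ 1 ^ 2) := by
    refine intervalIntegral.integral_nonneg b.L_pos.le fun ξ hξ => ?_
    have := b.γ_pos ξ hξ
    have := b.δ_pos ξ hξ
    positivity
  have hL : b.L ∈ Icc 0 b.L := ⟨b.L_pos.le, le_rfl⟩
  have h2 : 0 ≤ C₂ (z : b.Z) ⬝ᵥ (b.S b.L *ᵥ C₂ (z : b.Z)) := by
    simp only [S, Matrix.mulVec_diagonal, dotProduct, Fin.sum_univ_two, Matrix.cons_val_zero,
      Matrix.cons_val_one]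
    nlinarith [mul_nonneg (b.γ_pos _ hL).le (sq_nonneg (C₂ (z : b.Z) 0)),
      mul_nonneg (b.δ_pos _ hL).le (sq_nonneg (C₂ (z : b.Z) 1))]
  linarith

/-! ### Invertibility of `𝒥` -/

/-- The homogeneous system is triangular in the order 1, 0, 2, 3: each component has zero derivative
once the earlier ones vanish, and its boundary value is then zero too. -/
theorem J_injective : Function.Injective b.J.toFun := by
  rw [injective_iff_map_eq_zero]
  intro z hz
  set u := coenergyRep (z : b.Z) with hu
  have hr : ∀ i, IsH1Rep b.L (coenergy (z : b.Z) i) (u i) := fun i => (z.2.1 i).isH1Rep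
  have h0 : comp (b.J z) =ᵐ[b.μ] 0 := by
    have h := comp_smul 0 (b.J z)
    have hz' : b.J z = 0 := hz
    rw [hz', smul_zero] at h
    rw [hz']
    filter_upwards [h] with ξ hξ
    rw [hξ, zero_smul]; rfl
  have hJ : ∀ᵐ ξ ∂b.μ, ∀ i, (JFun (z : b.Z) ξ : Fin 4 → ℝ) i = 0 := by
    filter_upwards [h0, comp_J z] with ξ h1 h2 i
    rw [← h2, h1]; rfl
  simp only [JFun_apply, ← hu, Fin.forall_fin_succ] at hJ
  obtain ⟨hb0, hb1, hb2, hb3⟩ := coenergyRep_bdry z.2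
  rw [← hu] at hb0 hb1 hb2 hb3
  have h0m : (0 : ℝ) ∈ Icc 0 b.L := ⟨le_rfl, b.L_pos.le⟩
  have hLm : b.L ∈ Icc 0 b.L := ⟨b.L_pos.le, le_rfl⟩
  have e1 : ∀ ξ ∈ Icc 0 b.L, u 1 ξ = 0 := fun ξ hξ => by
    rw [(hr 1).ac.eq_of_deriv_ae_eq_zero ?_ hξ h0m, hb1]
    filter_upwards [hJ] with ξ h
    simpa using h.2.2.2.1
  have e0 : ∀ ξ ∈ Icc 0 b.L, u 0 ξ = 0 := fun ξ hξ => by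
    rw [(hr 0).ac.eq_of_deriv_ae_eq_zero ?_ hξ h0m, hb0]
    filter_upwards [hJ, ae_restrict_mem measurableSet_Icc] with ξ h hξ
    simpa [e1 ξ hξ] using h.2.2.1
  have e2 : ∀ ξ ∈ Icc 0 b.L, u 2 ξ = 0 := fun ξ hξ => by
    rw [(hr 2).ac.eq_of_deriv_ae_eq_zero ?_ hξ hLm, hb2, e0 _ hLm, mul_zero, neg_zero]
    filter_upwards [hJ, ae_restrict_mem measurableSet_Icc] with ξ h hξ
    simpa [e0 ξ hξ] using h.1
  have e3 : ∀ ξ ∈ Icc 0 b.L, u 3 ξ = 0 := fun ξ hξ => by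
    rw [(hr 3).ac.eq_of_deriv_ae_eq_zero ?_ hξ hLm, hb3, e1 _ hLm, mul_zero, neg_zero]
    filter_upwards [hJ, ae_restrict_mem measurableSet_Icc] with ξ h hξ
    simpa [e1 ξ hξ, e2 ξ hξ] using h.2.1
  have hzero : ∀ i, ∀ ξ ∈ Icc 0 b.L, u i ξ = 0 := by
    intro i; fin_cases i
    exacts [e0, e1, e2, e3]
  apply Subtype.ext
  refine eq_of_comp_ae_eq ?_
  have hz0 := comp_smul 0 (z : b.Z)
  rw [zero_smul] at hz0
  have hae : ∀ᵐ ξ ∂b.μ, ∀ i, coenergy (z : b.Z) i ξ = u i ξ := ae_all_iff.2 fun i => (hr i).ae_eq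
  filter_upwards [hae, hz0, ae_restrict_mem measurableSet_Icc] with ξ h1 h2 hξ
  ext i
  have h3 := h1 i
  rw [hzero i ξ hξ, coenergy_apply] at h3
  have h4 := (mul_eq_zero.1 h3).resolve_left (h_pos hξ i).ne'
  rw [h4]
  exact (congrFun h2 i |>.trans (by simp)).symm

theorem exists_comp_ae_eq {f : Fin 4 → ℝ → ℝ} (hf : ∀ i, MemLp (f i) 2 b.μ) :
    ∃ z : b.Z, ∀ᵐ ξ ∂b.μ, ∀ i, comp z ξ i = f i ξ := by
  have hm : MemLp (fun ξ => (WithLp.toLp 2 fun i => f i ξ : EuclideanSpace ℝ (Fin 4))) 2 b.μ := by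
    rw [memLp_piLp_iff]
    exact hf
  refine ⟨b.toL2.symm (hm.toLp _), ?_⟩
  filter_upwards [hm.coeFn_toLp] with ξ hξ i
  exact congrArg (fun v : EuclideanSpace ℝ (Fin 4) => v i) hξ

theorem memLp_of_continuousOn {f : ℝ → ℝ} (hf : ContinuousOn f (Icc 0 b.L)) :
    MemLp f 2 b.μ := by
  have := memLp_continuousOn_mul (b := b) hf (memLp_const (1 : ℝ))
  simpa only [mul_one] using this

theorem J_surjective : Function.Surjective b.J.toFun := by
  intro w
  have h0m : (0 : ℝ) ∈ Icc 0 b.L := ⟨le_rfl, b.L_pos.le⟩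
  have hLm : b.L ∈ Icc 0 b.L := ⟨b.L_pos.le, le_rfl⟩
  have hf := memLp_comp w
  obtain ⟨u1, r1, d1, i1⟩ := exists_primitive b.L_pos (hf 3) h0m 0
  have m1 := r1.continuousOn b.L_pos
  obtain ⟨u0, r0, d0, i0⟩ := exists_primitive b.L_pos
    ((hf 2).add (memLp_of_continuousOn m1)) h0m 0
  have m0 := r0.continuousOn b.L_pos
  -- With `u0` and `u1` known at `L`, the feedback condition supplies terminal values for `u2` and
  -- `u3`.
  obtain ⟨u2, r2, d2, i2⟩ := exists_primitive b.L_pos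
    ((hf 0).add (memLp_of_continuousOn ((continuousOn_of_ac b.γ_ac).mul m0))) hLm
    (-(b.γ b.L * u0 b.L))
  have m2 := r2.continuousOn b.L_pos
  obtain ⟨u3, r3, d3, i3⟩ := exists_primitive b.L_pos
    ((hf 1).add (memLp_of_continuousOn (((continuousOn_of_ac b.δ_ac).mul m1).sub m2))) hLm
    (-(b.δ b.L * u1 b.L))
  let u : Fin 4 → ℝ → ℝ := ![u0, u1, u2, u3]
  have hr : ∀ i, IsH1Rep b.L (u i) (u i) := by
    intro i; fin_cases i
    exacts [r0, r1, r2, r3]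
  -- The state is recovered as `z = ℋ⁻¹u`.
  obtain ⟨z, hz⟩ := exists_comp_ae_eq (b := b) (f := fun i ξ => u i ξ / b.h ξ i) fun i =>
    memLp_of_continuousOn (((hr i).continuousOn b.L_pos).div (continuousOn_h i)
      fun ξ hξ => (h_pos hξ i).ne')
  have hrep : ∀ i, IsH1Rep b.L (coenergy z i) (u i) := fun i => (hr i).congr <| by
    filter_upwards [hz, ae_restrict_mem measurableSet_Icc] with ξ h hξ
    rw [coenergy_apply, h, mul_div_cancel₀ _ (h_pos hξ i).ne']
  have hmem : z ∈ b.domJ := by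
    refine ⟨fun i => ⟨_, hrep i⟩, ?_, ?_⟩
    · ext i
      fin_cases i
      · simpa [B₁, coenergyRep_zero (hrep _), u] using i0
      · simpa [B₁, coenergyRep_zero (hrep _), u] using i1
    · ext i
      fin_cases i
      · simpa [B₂, C₂, S, Matrix.mulVec_diagonal, coenergyRep_L (hrep _), u] using i2
      · simpa [B₂, C₂, S, Matrix.mulVec_diagonal, coenergyRep_L (hrep _), u] using i3
  refine ⟨⟨z, hmem⟩, eq_of_comp_ae_eq ((comp_J ⟨z, hmem⟩).trans ?_)⟩
  have hd : ∀ᵐ ξ ∂b.μ, ∀ i, deriv (coenergyRep z i) ξ = deriv (u i) ξ := ae_all_iff.2 fun i =>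
    (MemH1.isH1Rep ⟨_, hrep i⟩).deriv_ae_eq b.L_pos (hrep i)
  filter_upwards [hd, d0, d1, d2, d3, ae_restrict_mem measurableSet_Icc]
    with ξ hd h0 h1 h2 h3 hξ
  have hv : ∀ i, coenergyRep z i ξ = u i ξ := fun i => coenergyRep_eqOn (hrep i) hξ
  rw [JFun_apply]
  simp only [hd, hv]
  ext i
  fin_cases i
  · simp [u, h2]
  · simp [u, h3]
    ring
  · simp [u, h0]
  · simp [u, h1]

end TimoshenkoBeam

end

/-! ### Generation and energy balance for the beam -/

theorem mainTheorem2 (b : TimoshenkoBeam) :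
    ∃ T : C0Semigroup b.Z, T.IsContraction ∧ T.IsGeneratedBy b.J ∧
      ∀ z : b.J.domain,
        Tendsto (fun t : ℝ≥0 =>
            (TimoshenkoBeam.energy (T.toFun t (z : b.Z)) - TimoshenkoBeam.energy (z : b.Z)) / (t : ℝ))
          (𝓝[>] 0) (𝓝 (inner ℝ (b.J z) (z : b.Z))) ∧
        T.diniDeriv TimoshenkoBeam.energy (z : b.Z) = ((inner ℝ (b.J z) (z : b.Z) : ℝ) : EReal) ∧
        inner ℝ (b.J z) (z : b.Z) =
          -(∫ ξ in 0..b.L,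
              (b.γ ξ / b.ρ ξ ^ 2 * TimoshenkoBeam.comp (z : b.Z) ξ 0 ^ 2 +
                b.δ ξ / b.Iρ ξ ^ 2 * TimoshenkoBeam.comp (z : b.Z) ξ 1 ^ 2)) -
            TimoshenkoBeam.C₂ (z : b.Z) ⬝ᵥ (b.S b.L *ᵥ TimoshenkoBeam.C₂ (z : b.Z)) := by
  obtain ⟨T, hT, hgen⟩ := b.J.exists_contraction_semigroup_of_dissipative
    TimoshenkoBeam.inner_J_nonpos ⟨TimoshenkoBeam.J_injective, TimoshenkoBeam.J_surjective⟩
  refine ⟨T, hT, hgen, fun z => ?_⟩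
  have h := T.tendsto_half_inner_self ((hgen z (b.J z)).1 (b.J.mem_graph z))
  exact ⟨h, ((continuous_coe_real_ereal.tendsto _).comp h).limsup_eq, TimoshenkoBeam.inner_J z⟩
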